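/- Let $d\ge 1$ and let $\mathscr T_1,\dots,\mathscr T_d$ be directed trees, $\mathscr T_j=(V_j,\mathcal E_j)$, each of which is rooted (with root $\mathsf{root}_j$), locally finite (every vertex has finitely many children) and leafless (every vertex has a child). Let $\mathscr T$ be their directed Cartesian product, with vertex set $V=V_1\times\cdots\times V_d$, where $(v,w)$ is an edge if and only if, for some $k$, $(v_k,w_k)\in\mathcal E_k$ and $v_j=w_j$ for all $j\ne k$; put $\mathsf{root}=(\mathsf{root}_1,\dots,\mathsf{root}_d)$. Let $\{\lambda^{(j)}_v: v\in V\setminus\{\mathsf{root}\},\ 1\le j\le d\}$ be nonzero complex numbers. For $v\in V$ with $v_j\neq\mathsf{root}_j$ let $\mathsf{par}_j(v)$ be $v$ with $v_j$ replaced by its parent in $\mathscr T_j$. Let $S_{\boldsymbol\lambda}=(S_1,\dots,S_d)$ be the associated multishift on $l^2(V)$, $$(S_jf)(v)=\lambda^{(j)}_v f(\mathsf{par}_j(v))\ \text{ if } v_j\ne\mathsf{root}_j,\qquad (S_jf)(v)=0\ \text{ if } v_j=\mathsf{root}_j,$$ and assume that each $S_j$ is a bounded operator on all of $l^2(V)$.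 Assume further that: 1. $S_{\boldsymbol\lambda}$ is toral left invertible, i.e. $S_1,\dots,S_d$ commute with each other and every $S_j^*S_j$ is invertible; 2. its toral Cauchy dual $S^{\mathfrak t}_{\boldsymbol\lambda}=(S_1^{\mathfrak t},\dots,S_d^{\mathfrak t})$, $S_j^{\mathfrak t}:=S_j(S_j^*S_j)^{-1}$, is commuting; 3. $S_{\boldsymbol\lambda}$ satisfies the kernel condition $(\mathfrak K)$: with $E:=\bigcap_{j=1}^d\ker S_j^*$, one has $E\subseteq\ker\big(S_j^*\prod_{i\ne j}(S_i^{\mathfrak t})^{\alpha_i}\big)$ for all $j=1,\dots,d$ and all $\alpha\in\mathbb N^d$. Let $r_j:=r(S_j^{\mathfrak t})^{-1}$, where $r(\cdot)$ is the spectral radius, and $\mathbb D^d_r=\{z\in\mathbb C^d:|z_j|<r_j,\ j=1,\dots,d\}$. Then there exist a reproducing kernel Hilbert space $\mathscr H$ of $E$-valued holomorphic functions on $\mathbb D^d_r$, on which the operators $\mathscr M_{z_j}$ of multiplication by the coordinate functions are bounded, and a unitary $U:l^2(V)\to\mathscr H$ such that $US_j=\mathscr M_{z_j}U$ for $j=1,\dots,d$.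 If, in addition, $\mathscr T$ has finite joint branching index, that is, $k_{\mathscr T_j}<\infty$ for every $j$, then the reproducing kernel of this $\mathscr H$ is $$\kappa_{\mathscr H}(z,w)=\sum_{\substack{\alpha,\beta\in\mathbb N^d\\ |\alpha_j-\beta_j|\le k_{\mathscr T_j},\ j=1,\dots,d}}P_E\,S_{\boldsymbol\lambda}^{\mathfrak t*\alpha}S_{\boldsymbol\lambda}^{\mathfrak t\beta}|_E\;z^\alpha\overline w^{\,\beta}\qquad(z,w\in\mathbb D^d_r),$$ the sum converging unconditionally in the norm of $B(E)$. Here $P_E$ is the orthogonal projection of $l^2(V)$ onto $E$, $S_{\boldsymbol\lambda}^{\mathfrak t\beta}=\prod_j(S_j^{\mathfrak t})^{\beta_j}$, $S_{\boldsymbol\lambda}^{\mathfrak t*\alpha}=\prod_j(S_j^{\mathfrak t*})^{\alpha_j}$, and the branching index $k_{\mathscr T_j}\in\mathbb N\cup\{\infty\}$ is $0$ if no vertex of $\mathscr T_j$ has two or more children, and otherwise $1$ plus the supremum of the depths (distances from $\mathsf{root}_j$) of the vertices of $\mathscr T_j$ with at least two children. -/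

import Mathlib

open scoped ENNReal InnerProductSpace ComplexConjugate

namespace TreeShift

/-! ### Directed trees -/

section Graph

variable {V : Type*}

/-- `Chi(W)`, the set of children of the vertices in `W`. -/
def children (G : Digraph V) (W : Set V) : Set V := {v | ∃ u ∈ W, G.Adj u v}

/-- `Chi^⟨n⟩(W)`, the `n`-fold iterate of `Chi`. -/
def childrenIter (G : Digraph V) : ℕ → Set V → Set V
  | 0, W => W
  | n + 1, W => children G (childrenIter G n W)

/-- A root is a vertex without incoming edges. -/
def IsRoot (G : Digraph V) (v : V) : Prop := ∀ u, ¬ G.Adj u v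

/-- Two vertices are connected by a path: there is a finite sequence of distinct vertices from
`u` to `v`, consecutive members of which are joined by an edge in one of the two directions. -/
def ConnectedByPath (G : Digraph V) (u v : V) : Prop :=
  ∃ (n : ℕ) (p : Fin (n + 1) → V), Function.Injective p ∧ p 0 = u ∧ p (Fin.last n) = v ∧
    ∀ i : Fin n, G.Adj (p i.castSucc) (p i.succ) ∨ G.Adj (p i.succ) (p i.castSucc)

/-- A circuit: at least two distinct vertices `p 0 → p 1 → ⋯ → p (n + 1) → p 0`. -/
def IsCircuit (G : Digraph V) {n : ℕ} (p : Fin (n + 2) → V) : Prop :=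
  Function.Injective p ∧ (∀ i : Fin (n + 1), G.Adj (p i.castSucc) (p i.succ)) ∧
    G.Adj (p (Fin.last (n + 1))) (p 0)

/-- Directed trees: the vertex set and the edge set are nonempty, there are no loops and no
circuits, any two distinct vertices are connected by a path, and every vertex which is not a root
has a unique parent. -/
structure IsDirectedTree (G : Digraph V) : Prop where
  nonempty_vertices : Nonempty V
  nonempty_edges : ∃ u v, G.Adj u v
  no_loops : ∀ v, ¬ G.Adj v v
  no_circuits : ∀ (n : ℕ) (p : Fin (n + 2) → V), ¬ IsCircuit G p
  connected : ∀ u v, u ≠ v → ConnectedByPath G u v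
  unique_parent : ∀ v, ¬ IsRoot G v → ∃! u, G.Adj u v

/-- A digraph is rooted if it has a unique root. -/
def IsRooted (G : Digraph V) : Prop := ∃! v, IsRoot G v

/-- Every vertex has finitely many children. -/
def IsLocallyFinite (G : Digraph V) : Prop := ∀ u, (children G {u}).Finite

/-- Every vertex has at least one child. -/
def IsLeafless (G : Digraph V) : Prop := ∀ u, (children G {u}).Nonempty

open Classical in
/-- The parent of a vertex `v` which is not a root (and `v` itself if `v` is a root). -/
noncomputable def parent (G : Digraph V) (v : V) : V :=
  if h : ∃ u, G.Adj u v then h.choose else v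

/-- The depth of `v` in a rooted directed tree: the (unique) `n` with `v ∈ Chi^⟨n⟩(root)`. -/
noncomputable def depth (G : Digraph V) (v : V) : ℕ :=
  sInf {n | ∃ ρ, IsRoot G ρ ∧ v ∈ childrenIter G n {ρ}}

/-- The set of branching vertices, those with at least two children. -/
def branchingVertices (G : Digraph V) : Set V := {u | 2 ≤ (children G {u}).encard}

open Classical in
/-- The branching index of a rooted directed tree. -/
noncomputable def branchingIndex (G : Digraph V) : ℕ∞ :=
  if (branchingVertices G).Nonempty then 1 + ⨆ w ∈ branchingVertices G, (depth G w : ℕ∞) else 0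

end Graph

section Product

variable {d : ℕ} {V : Fin d → Type*}

/-- The directed Cartesian product of the digraphs `T 0, …, T (d - 1)`. -/
def cartesianProduct (T : ∀ j, Digraph (V j)) : Digraph (∀ j, V j) where
  Adj v w := ∃ k, (∀ j, j ≠ k → v j = w j) ∧ (T k).Adj (v k) (w k)

/-! ### Multishifts -/

/-- The Hilbert space `l²(X)` of square summable complex functions on `X`. -/
noncomputable abbrev L2 (X : Type*) := lp (fun _ : X => ℂ) 2

open Classical in
/-- The map `Λ^{(j)}` on all complex functions on the vertices of the product: `(Λ^{(j)} f) v` is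
`lam j v * f (par_j v)` if `v j` is not a root, where `par_j v` is `v` with its `j`-th coordinate
replaced by the parent of `v j`, and `0` if `v j` is a root. -/
noncomputable def shiftAction (T : ∀ j, Digraph (V j)) (lam : Fin d → (∀ j, V j) → ℂ) (j : Fin d) :
    ((∀ j, V j) → ℂ) →ₗ[ℂ] ((∀ j, V j) → ℂ) where
  toFun f v := if IsRoot (T j) (v j) then 0 else
    lam j v * f (Function.update v j (parent (T j) (v j)))
  map_add' f g := by
    ext v
    by_cases h : IsRoot (T j) (v j) <;> simp [h, mul_add]
  map_smul' c f := by
    ext v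
    by_cases h : IsRoot (T j) (v j) <;> simp [h, mul_left_comm]

/-- The `j`-th member of the multishift with weights `lam`, as a possibly unbounded operator in
`l²(V)`: its domain consists of all `f` in `l²(V)` with `Λ^{(j)} f` in `l²(V)`. -/
noncomputable def multishift (T : ∀ j, Digraph (V j)) (lam : Fin d → (∀ j, V j) → ℂ) (j : Fin d) :
    L2 (∀ j, V j) →ₗ.[ℂ] L2 (∀ j, V j) where
  domain :=
    { carrier := {f | Memℓp (shiftAction T lam j f) 2}
      add_mem' := fun {f g} hf hg => by
        have h := Memℓp.add hf hg
        rwa [← map_add] at h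
      zero_mem' := by
        have h : Memℓp (0 : (∀ j, V j) → ℂ) 2 := zero_memℓp
        rwa [← map_zero (shiftAction T lam j)] at h
      smul_mem' := fun c f hf => by
        have h := Memℓp.const_smul (𝕜 := ℂ) hf c
        rwa [← map_smul] at h }
  toFun :=
    { toFun := fun f => ⟨shiftAction T lam j f.1, f.2⟩
      map_add' := fun f g => Subtype.ext (map_add (shiftAction T lam j) _ _)
      map_smul' := fun c f => Subtype.ext (map_smul (shiftAction T lam j) _ _) }

/-- The multishift with weights `lam` consists of operators in `B(l²(V))`, namely of the bounded,
everywhere defined operators `S 0, …, S (d - 1)`. -/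
def IsBoundedMultishift (T : ∀ j, Digraph (V j)) (lam : Fin d → (∀ j, V j) → ℂ)
    (S : Fin d → L2 (∀ j, V j) →L[ℂ] L2 (∀ j, V j)) : Prop :=
  ∀ j, multishift T lam j = (S j : L2 (∀ j, V j) →ₗ[ℂ] L2 (∀ j, V j)).toPMap ⊤

end Product

/-! ### Tuples of operators -/

section Tuples

variable {d : ℕ} {H : Type*} [NormedAddCommGroup H] [InnerProductSpace ℂ H] [CompleteSpace H]

/-- The tuple consists of commuting operators. -/
def IsCommuting (A : Fin d → H →L[ℂ] H) : Prop := ∀ i j, Commute (A i) (A j)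

/-- `A^α = A_1^{α_1} ⋯ A_d^{α_d}`. -/
noncomputable def opPow (A : Fin d → H →L[ℂ] H) (α : Fin d → ℕ) : H →L[ℂ] H :=
  (List.ofFn fun j => A j ^ α j).prod

/-- The tuple `A* = (A_1*, …, A_d*)`. -/
noncomputable def adjointTuple (A : Fin d → H →L[ℂ] H) (j : Fin d) : H →L[ℂ] H :=
  ContinuousLinearMap.adjoint (A j)

/-- A commuting tuple is toral left invertible if every `A_j* A_j` is invertible in `B(H)`. -/
def IsToralLeftInvertible (A : Fin d → H →L[ℂ] H) : Prop :=
  IsCommuting A ∧ ∀ j, IsUnit (adjointTuple A j * A j)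

/-- The toral Cauchy dual, with members `A_j (A_j* A_j)⁻¹`. -/
noncomputable def toralCauchyDual (A : Fin d → H →L[ℂ] H) (j : Fin d) : H →L[ℂ] H :=
  A j * Ring.inverse (adjointTuple A j * A j)

/-- The joint kernel `E` of the tuple `A*`. -/
noncomputable def jointKernel (A : Fin d → H →L[ℂ] H) : Submodule ℂ H :=
  ⨅ j, (adjointTuple A j).ker

theorem isClosed_jointKernel (A : Fin d → H →L[ℂ] H) : IsClosed (jointKernel A : Set H) := by
  simp only [jointKernel, Submodule.coe_iInf]
  exact isClosed_iInter fun j => (adjointTuple A j).isClosed_ker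

instance (A : Fin d → H →L[ℂ] H) : CompleteSpace (jointKernel A) :=
  (isClosed_jointKernel A).completeSpace_coe

/-- The kernel condition `(𝔎)`: `E ⊆ ker A_j* (A^𝔱)_{[j]}^α` for all `j` and `α`, where
`(A^𝔱)_{[j]}^α` is the product of the powers `(A_i^𝔱)^{α_i}` over the indices `i ≠ j`. -/
def KernelCondition (A : Fin d → H →L[ℂ] H) : Prop :=
  ∀ (j : Fin d) (α : Fin d → ℕ),
    jointKernel A ≤
      (adjointTuple A j * opPow (toralCauchyDual A) (Function.update α j 0)).ker

/-- The operator `P_E A^{𝔱*α} A^{𝔱β}|_E` on the joint kernel `E` of `A*`. -/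
noncomputable def kernelCoeff (A : Fin d → H →L[ℂ] H) (α β : Fin d → ℕ) :
    jointKernel A →L[ℂ] jointKernel A :=
  (jointKernel A).orthogonalProjectionOnto ∘L
    (opPow (adjointTuple (toralCauchyDual A)) α * opPow (toralCauchyDual A) β) ∘L
      (jointKernel A).subtypeL

/-- The reciprocals `r(A_j^𝔱)⁻¹` of the spectral radii of the members of the Cauchy dual. -/
noncomputable def modelRadius (A : Fin d → H →L[ℂ] H) (j : Fin d) : ℝ≥0∞ :=
  (spectralRadius ℂ (toralCauchyDual A j))⁻¹

end Tuples

/-! ### Functions on polydiscs -/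

/-- The open polydisc of polyradius `r` centered at the origin. -/
def polydisc {d : ℕ} (r : Fin d → ℝ≥0∞) : Set (Fin d → ℂ) := {z | ∀ j, ‖z j‖ₑ < r j}

/-- `F` is a holomorphic function on the polydisc of polyradius `r`. -/
def IsHolomorphicOnPolydisc {d : ℕ} {r : Fin d → ℝ≥0∞} {E : Type*} [NormedAddCommGroup E]
    [NormedSpace ℂ E] (F : polydisc r → E) : Prop :=
  ∃ G : (Fin d → ℂ) → E, DifferentiableOn ℂ G (polydisc r) ∧ ∀ z : polydisc r, F z = G z

end TreeShift

open TreeShift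

universe u

/-!
Write `A` for the toral Cauchy dual of `S` and `E` for the joint kernel of `S*`. The model of `S` is
the Hilbert space `l²(V)` itself, in which `f` is regarded as the `E`-valued function
`z ↦ ∑ z^α P_E A^{*α} f` (`modelEval`); the unitary is the identity. Since
`∑ z^α A^{*α} = ∏ (1 - z_j A_j*)⁻¹` on the polydisc of the reciprocal spectral radii
(`hasSum_jointResolvent`), these functions are holomorphic and the evaluations are bounded.

The resolvent identity `modelEval_apply_eq_update_add`, which compares the values at `z` and at `z`
with its `j`-th coordinate replaced by `0`, serves twice. With `A_j* S_j = 1` and the kernel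
condition it shows that `S_j` becomes the multiplication by `z_j` (`modelEval_apply_apply`); and it
shows that the vectors represented by the zero function form a space invariant under each `A_j*`,
so that such a vector is orthogonal to `A^α E` for all `α`
(`inner_opPow_eq_zero_of_modelEval_eq_zero`).

What remains is that the spaces `A^α E` span a dense subspace. Because `S_j*` moves the standard
basis vectors of `l²(V)` towards the root, only finitely many monomials `S*^γ` fail to annihilate
a given basis vector `f`. If `γ` is maximal with `x = S*^γ f ≠ 0`, then `x` lies in `E`, and by the
kernel condition the set of the multi-indices `δ` with `S*^δ (f - A^γ x) ≠ 0` is strictly smaller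
than that for `f`. Induction gives `f` as a finite sum of vectors in the spaces `A^γ E`
(`mem_iSup_map_opPow`).

The reproducing kernel is the composition of the evaluation at `z` with the adjoint of that at `w`,
hence the product of two absolutely convergent series (`hasSum_modelEval_comp_adjoint`). Its
coefficients outside the band vanish for reasons of support
(`IsBoundedMultishift.kernelCoeff_eq_zero`): the members of `E` live on vertices whose `j`-th depth
is at most the `j`-th branching index, and `A_j` raises the `j`-th depth by exactly one.
-/

namespace TreeShift

/-! ### Monomials in a tuple of operators -/

section Monomials

variable {d : ℕ} {H : Type*} [NormedAddCommGroup H] [InnerProductSpace ℂ H]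

theorem multiIndex_induction {P : (Fin d → ℕ) → Prop} (zero : P 0)
    (add_single : ∀ α j, P α → P (α + Pi.single j 1)) (α : Fin d → ℕ) : P α := by
  induction h : ∑ j, α j generalizing α with
  | zero =>
    have : α = 0 := funext fun j => by simpa using (Finset.sum_eq_zero_iff.mp h) j
    exact this ▸ zero
  | succ n ih =>
    obtain ⟨j, hj⟩ : ∃ j, α j ≠ 0 := by
      by_contra! h0
      simp [h0] at h
    have hα : α - Pi.single j 1 + Pi.single j 1 = α := by
      refine tsub_add_cancel_of_le fun i => ?_
      rcases eq_or_ne i j with rfl | hij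
      · simpa using Nat.one_le_iff_ne_zero.mpr hj
      · simp [hij]
    rw [← hα]
    refine add_single _ _ (ih _ ?_)
    have h2 : ∑ i, (α - Pi.single j 1 + Pi.single j 1 : Fin d → ℕ) i = n + 1 := by rw [hα, h]
    simp only [Pi.add_apply, Finset.sum_add_distrib] at h2
    simpa using h2

theorem opPow_succ (A : Fin (d + 1) → H →L[ℂ] H) (α : Fin (d + 1) → ℕ) :
    opPow A α = A 0 ^ α 0 * opPow (fun j => A j.succ) (fun j => α j.succ) := by
  simp [opPow, List.ofFn_succ]

@[simp]
theorem opPow_zero_right (A : Fin d → H →L[ℂ] H) : opPow A 0 = 1 := by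
  simp [opPow]

theorem commute_opPow {A : Fin d → H →L[ℂ] H} {B : H →L[ℂ] H} (h : ∀ j, Commute B (A j))
    (α : Fin d → ℕ) : Commute B (opPow A α) := by
  refine Commute.list_prod_right _ _ fun x hx => ?_
  obtain ⟨j, rfl⟩ := (List.mem_ofFn' _ _).mp hx
  exact (h j).pow_right _

theorem opPow_add {A : Fin d → H →L[ℂ] H} (hA : IsCommuting A) (α β : Fin d → ℕ) :
    opPow A (α + β) = opPow A α * opPow A β := by
  induction d with
  | zero => simp [opPow]
  | succ d ih =>
    have hc := commute_opPow (B := A 0 ^ β 0) (A := fun j : Fin d => A j.succ)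
      (fun j => (hA 0 j.succ).pow_left _) (fun j => α j.succ)
    have h2 := ih (A := fun j : Fin d => A j.succ) (fun i j => hA _ _)
      (fun j => α j.succ) (fun j => β j.succ)
    simp only [opPow_succ, Pi.add_apply, pow_add]
    rw [show (fun j : Fin d => α j.succ + β j.succ)
      = (fun j => α j.succ) + fun j => β j.succ from rfl, h2, mul_assoc, mul_assoc,
      ← mul_assoc (A 0 ^ β 0), hc.eq]
    simp only [mul_assoc]

theorem opPow_single (A : Fin d → H →L[ℂ] H) (j : Fin d) (n : ℕ) :
    opPow A (Pi.single j n) = A j ^ n := by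
  induction d with
  | zero => exact j.elim0
  | succ d ih =>
    rw [opPow_succ]
    induction j using Fin.cases with
    | zero =>
      rw [show (fun i : Fin d => (Pi.single 0 n : Fin (d + 1) → ℕ) i.succ) = 0 from
        funext fun i => by simp]
      simp
    | succ j =>
      rw [show (fun i : Fin d => (Pi.single j.succ n : Fin (d + 1) → ℕ) i.succ) = Pi.single j n
        from funext fun i => by simp [Pi.single_apply], ih]
      simp

theorem opPow_add_single {A : Fin d → H →L[ℂ] H} (hA : IsCommuting A) (α : Fin d → ℕ)
    (j : Fin d) : opPow A (α + Pi.single j 1) = A j * opPow A α := by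
  rw [add_comm, opPow_add hA, opPow_single, pow_one]

theorem opPow_smul (z : Fin d → ℂ) (A : Fin d → H →L[ℂ] H) (α : Fin d → ℕ) :
    opPow (fun j => z j • A j) α = (∏ j, z j ^ α j) • opPow A α := by
  induction d with
  | zero => simp [opPow]
  | succ d ih =>
    rw [opPow_succ, opPow_succ, Fin.prod_univ_succ, smul_pow, ← smul_mul_smul_comm]
    congr 1
    exact ih (fun j => z j.succ) (fun j => A j.succ) _

variable [CompleteSpace H]

theorem IsCommuting.adjointTuple {A : Fin d → H →L[ℂ] H} (hA : IsCommuting A) :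
    IsCommuting (adjointTuple A) := fun i j => (hA i j).star_star

theorem adjoint_opPow {A : Fin d → H →L[ℂ] H} (hA : IsCommuting A) (α : Fin d → ℕ) :
    ContinuousLinearMap.adjoint (opPow A α) = opPow (adjointTuple A) α := by
  rw [← ContinuousLinearMap.star_eq_adjoint]
  induction α using multiIndex_induction with
  | zero => simp
  | add_single α j ih =>
    have h := (commute_opPow (fun i => hA.adjointTuple j i) α).eq
    rw [opPow_add_single hA, star_mul, ih, opPow_add_single hA.adjointTuple, h]
    rfl

end Monomials

/-! ### Multiple power series -/

/-- Cauchy products of finitely many absolutely convergent series in a Banach algebra, with the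
factors in a fixed order. -/
theorem hasSum_listProd {d : ℕ} {R : Type*} [NormedRing R] [CompleteSpace R]
    (c : Fin d → ℕ → R) (hc : ∀ j, Summable fun n => ‖c j n‖) :
    (Summable fun α : Fin d → ℕ => ‖(List.ofFn fun j => c j (α j)).prod‖) ∧
      HasSum (fun α : Fin d → ℕ => (List.ofFn fun j => c j (α j)).prod)
        (List.ofFn fun j => ∑' n, c j n).prod := by
  induction d with
  | zero =>
    refine ⟨Summable.of_finite, ?_⟩
    simp
  | succ d ih =>
    obtain ⟨h1, h2⟩ := ih (fun j => c j.succ) (fun j => hc j.succ)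
    let e : ℕ × (Fin d → ℕ) ≃ (Fin (d + 1) → ℕ) := Fin.consEquiv fun _ => ℕ
    have he : (fun α : Fin (d + 1) → ℕ => (List.ofFn fun j => c j (α j)).prod) ∘ e
        = fun p => c 0 p.1 * (List.ofFn fun j : Fin d => c j.succ (p.2 j)).prod := by
      funext p
      simp [e, List.ofFn_succ]
    have hs := (hc 0).mul_norm h1
    refine ⟨?_, ?_⟩
    · rw [← e.summable_iff]
      refine hs.congr fun p => ?_
      exact congrArg norm (congrFun he p).symm
    · rw [← e.hasSum_iff, he, List.ofFn_succ, List.prod_cons]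
      have h0 : HasSum (c 0) (∑' n, c 0 n) := (hc 0).of_norm.hasSum
      have hs' : Summable fun p : ℕ × (Fin d → ℕ) =>
          c 0 p.1 * (List.ofFn fun j : Fin d => c j.succ (p.2 j)).prod := hs.of_norm
      have h3 := HasSum.mul h0 h2 hs'
      exact h3

/-- Within the reciprocal of the spectral radius, the geometric series converges absolutely, even
though the norm of its ratio may exceed `1`. -/
theorem hasSum_geometric_of_lt_inv_spectralRadius {R : Type*} [NormedRing R] [NormedAlgebra ℂ R]
    [CompleteSpace R] (a : R) {z : ℂ} (hz : ‖z‖ₑ < (spectralRadius ℂ a)⁻¹) :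
    (Summable fun n => ‖(z • a) ^ n‖) ∧
      HasSum (fun n => (z • a) ^ n) (Ring.inverse (1 - z • a)) := by
  obtain ⟨r, hzr, hr⟩ := ENNReal.lt_iff_exists_nnreal_btwn.mp hz
  have hzr' : ((‖z‖₊ : NNReal) : ℝ≥0∞) < r := hzr
  have h := (spectrum.hasFPowerSeriesOnBall_inverse_one_sub_smul ℂ a).exchange_radius
    ((spectrum.differentiableOn_inverse_one_sub_smul hr).hasFPowerSeriesOnBall
      (lt_of_le_of_lt zero_le (ENNReal.coe_lt_coe.mp hzr')))
  constructor
  · have h2 := FormalMultilinearSeries.summable_norm_mul_pow _ (lt_of_lt_of_le hzr' h.r_le)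
    refine h2.congr fun n => ?_
    rw [smul_pow, norm_smul, ContinuousMultilinearMap.norm_mkPiRing, norm_pow z, mul_comm,
      coe_nnnorm]
  · have h2 := h.hasSum (y := z) (by rwa [Metric.mem_eball, edist_zero_right])
    simpa [smul_pow] using h2

theorem differentiableAt_listProd {d : ℕ} {R X : Type*} [NormedRing R] [NormedAlgebra ℂ R]
    [NormedAddCommGroup X] [NormedSpace ℂ X] (g : Fin d → X → R) {x : X}
    (hg : ∀ j, DifferentiableAt ℂ (g j) x) :
    DifferentiableAt ℂ (fun y => (List.ofFn fun j => g j y).prod) x := by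
  induction d with
  | zero => simp
  | succ d ih =>
    simp only [List.ofFn_succ, List.prod_cons]
    exact (hg 0).mul (ih _ fun j => hg j.succ)

theorem spectralRadius_star {R : Type*} [NormedRing R] [NormedAlgebra ℂ R] [CompleteSpace R]
    [StarRing R] [NormedStarGroup R] (a : R) : spectralRadius ℂ (star a) = spectralRadius ℂ a := by
  refine tendsto_nhds_unique (spectrum.pow_nnnorm_pow_one_div_tendsto_nhds_spectralRadius (star a))
    ((spectrum.pow_nnnorm_pow_one_div_tendsto_nhds_spectralRadius a).congr fun n => ?_)
  rw [← star_pow, nnnorm_star]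

theorem spectralRadius_lt_top {R : Type*} [NormedRing R] [NormedAlgebra ℂ R] [CompleteSpace R]
    (a : R) : spectralRadius ℂ a < ⊤ := by
  refine lt_of_le_of_lt (spectrum.spectralRadius_le_pow_nnnorm_pow_one_div ℂ a 0) ?_
  simpa using ENNReal.mul_lt_top ENNReal.coe_lt_top ENNReal.coe_lt_top

/-! ### The joint resolvent of a commuting tuple -/

section Resolvent

variable {d : ℕ} {H : Type*} [NormedAddCommGroup H] [InnerProductSpace ℂ H]

/-- The product of the resolvents `(1 - z_j B_j)⁻¹`, which is the sum of the series with terms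
`z^α B^α`. -/
noncomputable def jointResolvent (B : Fin d → H →L[ℂ] H) (z : Fin d → ℂ) : H →L[ℂ] H :=
  (List.ofFn fun j => Ring.inverse (1 - z j • B j)).prod

/-- The polydisc on which the joint resolvent of `B` is the sum of its power series. -/
noncomputable abbrev resolventPolydisc (B : Fin d → H →L[ℂ] H) : Set (Fin d → ℂ) :=
  polydisc fun j => (spectralRadius ℂ (B j))⁻¹

@[simp]
theorem jointResolvent_zero (B : Fin d → H →L[ℂ] H) : jointResolvent B 0 = 1 := by
  simp [jointResolvent]

variable [CompleteSpace H]

theorem update_mem_resolventPolydisc {B : Fin d → H →L[ℂ] H} {z : Fin d → ℂ}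
    (hz : z ∈ resolventPolydisc B) (j : Fin d) : Function.update z j 0 ∈ resolventPolydisc B := by
  intro i
  rcases eq_or_ne i j with rfl | hij
  · simpa using (spectralRadius_lt_top (B i)).ne
  · simpa [hij] using hz i

theorem zero_mem_resolventPolydisc (B : Fin d → H →L[ℂ] H) : 0 ∈ resolventPolydisc B := fun j => by
  simpa using (spectralRadius_lt_top (B j)).ne

theorem hasSum_jointResolvent (B : Fin d → H →L[ℂ] H) {z : Fin d → ℂ}
    (hz : z ∈ resolventPolydisc B) :
    (Summable fun α : Fin d → ℕ => ‖(∏ j, z j ^ α j) • opPow B α‖) ∧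
      HasSum (fun α : Fin d → ℕ => (∏ j, z j ^ α j) • opPow B α) (jointResolvent B z) := by
  have h := fun j => hasSum_geometric_of_lt_inv_spectralRadius (B j) (hz j)
  have h2 := hasSum_listProd (fun j n => (z j • B j) ^ n) fun j => (h j).1
  simp only [(h _).2.tsum_eq] at h2
  simp only [← opPow_smul]
  exact h2

theorem differentiableAt_jointResolvent (B : Fin d → H →L[ℂ] H) {z : Fin d → ℂ}
    (hz : z ∈ resolventPolydisc B) : DifferentiableAt ℂ (jointResolvent B) z := by
  refine differentiableAt_listProd _ fun j => ?_
  have hu : IsUnit (1 - z j • B j) := spectrum.isUnit_one_sub_smul_of_lt_inv_radius (hz j)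
  have h1 : DifferentiableAt ℂ (fun w : Fin d → ℂ => 1 - w j • B j) z := by fun_prop
  exact (differentiableAt_inverse hu).comp z h1

/-- The terms of the power series which are free of `z_j` add up to the value at `z` with its `j`-th
coordinate replaced by `0`; in the others a factor `z_j B_j` splits off. -/
theorem jointResolvent_eq_update_add {B : Fin d → H →L[ℂ] H} (hB : IsCommuting B) {z : Fin d → ℂ}
    (hz : z ∈ resolventPolydisc B) (j : Fin d) :
    jointResolvent B z
      = jointResolvent B (Function.update z j 0) + z j • (jointResolvent B z * B j) := by
  have h1 := (hasSum_jointResolvent B hz).2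
  have h0 := (hasSum_jointResolvent B (update_mem_resolventPolydisc hz j)).2
  have hi : Function.Injective fun α : Fin d → ℕ => α + Pi.single j 1 := add_left_injective _
  have h2 : HasSum (fun α : Fin d → ℕ => z j • ((∏ i, z i ^ α i) • opPow B α * B j))
      (jointResolvent B z - jointResolvent B (Function.update z j 0)) := by
    have hshift : (fun α : Fin d → ℕ => z j • ((∏ i, z i ^ α i) • opPow B α * B j)) =
        (fun α => (∏ i, z i ^ α i) • opPow B α - (∏ i, Function.update z j 0 i ^ α i) • opPow B α) ∘
          fun α : Fin d → ℕ => α + Pi.single j 1 := by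
      funext α
      have hc := (commute_opPow (fun i => hB j i) α).eq
      have hp : ∏ i, z i ^ (α + Pi.single j 1 : Fin d → ℕ) i = z j * ∏ i, z i ^ α i := by
        simp only [Pi.add_apply, pow_add, Finset.prod_mul_distrib]
        rw [mul_comm]
        congr 1
        rw [Finset.prod_eq_single j] <;> simp +contextual
      have hp0 : ∏ i, Function.update z j 0 i ^ (α + Pi.single j 1 : Fin d → ℕ) i = 0 :=
        Finset.prod_eq_zero (Finset.mem_univ j) (by simp)
      simp only [Function.comp_apply, hp, hp0, zero_smul, sub_zero, opPow_add_single hB, hc,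
        smul_mul_assoc, smul_smul]
    rw [hshift, hi.hasSum_iff]
    · exact h1.sub h0
    · intro α hα
      have hαj : α j = 0 := by
        by_contra h
        refine hα ⟨α - Pi.single j 1, tsub_add_cancel_of_le fun i => ?_⟩
        rcases eq_or_ne i j with rfl | hij
        · simpa using Nat.one_le_iff_ne_zero.mpr h
        · simp [hij]
      have hp : ∏ i, Function.update z j 0 i ^ α i = ∏ i, z i ^ α i := by
        refine Finset.prod_congr rfl fun i _ => ?_
        rcases eq_or_ne i j with rfl | hij
        · simp [hαj]
        · simp [hij]
      rw [hp, sub_self]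
  have h3 := (h1.mul_right (B j)).const_smul (z j)
  rw [h3.unique h2, add_sub_cancel]

end Resolvent

/-! ### The Cauchy dual and the kernel condition -/

section Dual

variable {d : ℕ} {H : Type*} [NormedAddCommGroup H] [InnerProductSpace ℂ H] [CompleteSpace H]
  {S : Fin d → H →L[ℂ] H}

theorem IsToralLeftInvertible.adjoint_mul_dual (hS : IsToralLeftInvertible S) (j : Fin d) :
    adjointTuple S j * toralCauchyDual S j = 1 := by
  rw [toralCauchyDual, ← mul_assoc]
  exact Ring.mul_inverse_cancel _ (hS.2 j)

theorem IsToralLeftInvertible.adjoint_dual_mul (hS : IsToralLeftInvertible S) (j : Fin d) :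
    adjointTuple (toralCauchyDual S) j * S j = 1 := by
  have h := congrArg star (hS.adjoint_mul_dual j)
  rw [star_mul, star_one] at h
  rw [← h, adjointTuple, adjointTuple, ContinuousLinearMap.star_eq_adjoint,
    ContinuousLinearMap.star_eq_adjoint, ContinuousLinearMap.adjoint_adjoint]

theorem mem_jointKernel {x : H} : x ∈ jointKernel S ↔ ∀ j, adjointTuple S j x = 0 := by
  simp [jointKernel]

theorem KernelCondition.apply_eq_zero (hK : KernelCondition S) {x : H} (hx : x ∈ jointKernel S)
    (j : Fin d) {α : Fin d → ℕ} (hα : α j = 0) :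
    adjointTuple S j (opPow (toralCauchyDual S) α x) = 0 := by
  have h := hK j α hx
  rwa [show Function.update α j 0 = α by rw [← hα, Function.update_eq_self]] at h

theorem opPow_adjoint_mul_dual (hS : IsToralLeftInvertible S)
    (hdual : IsCommuting (toralCauchyDual S)) (γ : Fin d → ℕ) :
    opPow (adjointTuple S) γ * opPow (toralCauchyDual S) γ = 1 := by
  induction γ using multiIndex_induction with
  | zero => simp
  | add_single γ j ih =>
    rw [opPow_add_single hS.1.adjointTuple, opPow_add_single hdual,
      (commute_opPow (fun i => hS.1.adjointTuple j i) γ).eq, mul_assoc,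
      ← mul_assoc (adjointTuple S j), hS.adjoint_mul_dual, one_mul, ih]

/-- If `δ_j > γ_j`, then `S_j*^{γ_j}` strips all factors `A_j` off `A^γ x`, where `A` is the
Cauchy dual of `S`, and a further factor `S_j*` annihilates the rest by the kernel condition. -/
theorem opPow_adjoint_apply_eq_zero (hS : IsToralLeftInvertible S)
    (hdual : IsCommuting (toralCauchyDual S)) (hK : KernelCondition S) {x : H}
    (hx : x ∈ jointKernel S) {γ δ : Fin d → ℕ} (hδ : ¬ δ ≤ γ) :
    opPow (adjointTuple S) δ (opPow (toralCauchyDual S) γ x) = 0 := by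
  obtain ⟨j, hj⟩ : ∃ j, γ j < δ j := by simpa [Pi.le_def] using hδ
  have h1 : δ = (δ - Pi.single j (γ j + 1)) + Pi.single j (γ j + 1) := by
    refine (tsub_add_cancel_of_le fun i => ?_).symm
    rcases eq_or_ne i j with rfl | hij
    · simpa using hj
    · simp [hij]
  have h2 : γ = Pi.single j (γ j) + Function.update γ j 0 := by
    funext i
    rcases eq_or_ne i j with rfl | hij <;> simp [*]
  have h3 : opPow (adjointTuple S) δ * opPow (toralCauchyDual S) γ
      = opPow (adjointTuple S) (δ - Pi.single j (γ j + 1)) *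
        (adjointTuple S j * opPow (toralCauchyDual S) (Function.update γ j 0)) := by
    conv_lhs => rw [h1, opPow_add hS.1.adjointTuple, h2, opPow_add hdual]
    rw [opPow_single, opPow_single]
    simp only [Function.update_self, Pi.add_apply, Pi.single_eq_same, add_zero]
    rw [pow_succ', mul_assoc, mul_assoc, ← mul_assoc (adjointTuple S j ^ _),
      pow_mul_pow_eq_one _ (hS.adjoint_mul_dual j), one_mul]
  have h4 := DFunLike.congr_fun h3 x
  simp only [mul_apply_eq_comp] at h4
  rw [h4, hK.apply_eq_zero hx j (by simp), map_zero]

/-- A vector which all but finitely many monomials in `S*` annihilate lies in the span of the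
spaces `A^β E`, where `A` is the Cauchy dual of `S`. If `γ` is maximal with
`x = S*^γ f ≠ 0`, then `x` lies in `E`, and passing from `f` to `f - A^γ x` removes `γ` from the
finite set of the multi-indices `δ` with `S*^δ f ≠ 0` and adds nothing to it. -/
theorem mem_iSup_map_opPow (hS : IsToralLeftInvertible S)
    (hdual : IsCommuting (toralCauchyDual S)) (hK : KernelCondition S) (f : H)
    (hf : {γ | opPow (adjointTuple S) γ f ≠ 0}.Finite) :
    f ∈ ⨆ β, (jointKernel S).map (opPow (toralCauchyDual S) β : H →ₗ[ℂ] H) := by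
  induction hn : {γ | opPow (adjointTuple S) γ f ≠ 0}.ncard using Nat.strong_induction_on
    generalizing f with
  | _ n ih =>
  rcases Set.eq_empty_or_nonempty {γ | opPow (adjointTuple S) γ f ≠ 0} with he | hne
  · have h0 : opPow (adjointTuple S) 0 f = 0 := by
      by_contra h
      exact (Set.mem_empty_iff_false _).mp (he ▸ h : (0 : Fin d → ℕ) ∈ (∅ : Set (Fin d → ℕ)))
    rw [opPow_zero_right] at h0
    rw [show f = 0 from h0]
    exact zero_mem _
  obtain ⟨γ, hγ⟩ := hf.exists_maximal hne
  set x := opPow (adjointTuple S) γ f with hx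
  have hxE : x ∈ jointKernel S := by
    refine mem_jointKernel.mpr fun j => ?_
    by_contra h
    have h2 : opPow (adjointTuple S) (γ + Pi.single j 1) f ≠ 0 := by
      rw [opPow_add_single hS.1.adjointTuple]
      exact h
    have h3 := hγ.2 h2 le_self_add j
    simp at h3
  have hx0 : x ≠ 0 := hγ.1
  have hmem : opPow (toralCauchyDual S) γ x ∈
      ⨆ β, (jointKernel S).map (opPow (toralCauchyDual S) β : H →ₗ[ℂ] H) :=
    Submodule.mem_iSup_of_mem γ ⟨x, hxE, rfl⟩
  have hsub : {δ | opPow (adjointTuple S) δ (f - opPow (toralCauchyDual S) γ x) ≠ 0} ⊂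
      {δ | opPow (adjointTuple S) δ f ≠ 0} := by
    refine Set.ssubset_iff_of_subset (fun δ hδ => ?_) |>.mpr ⟨γ, hγ.1, ?_⟩
    · by_cases hle : δ ≤ γ
      · intro h
        apply hx0
        rw [hx, ← tsub_add_cancel_of_le hle, opPow_add hS.1.adjointTuple,
          mul_apply_eq_comp, h, map_zero]
      · intro h
        refine hδ ?_
        rw [map_sub, h, opPow_adjoint_apply_eq_zero hS hdual hK hxE hle, sub_zero]
    · have h := DFunLike.congr_fun (opPow_adjoint_mul_dual hS hdual γ) x
      rw [mul_apply_eq_comp, one_apply_eq_self] at h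
      exact not_not.mpr (by rw [map_sub, h, ← hx, sub_self])
  have h := ih _ (hn ▸ Set.ncard_lt_ncard hsub hf) _ (hf.subset hsub.subset) rfl
  simpa using add_mem h hmem

end Dual

/-! ### The model map -/

section Model

variable {d : ℕ} {H : Type*} [NormedAddCommGroup H] [InnerProductSpace ℂ H] [CompleteSpace H]
  {S : Fin d → H →L[ℂ] H}

/-- The evaluation `f ↦ ∑ z^α P_E A^{*α} f` at `z` of the analytic model of `S`, where `A` is the
toral Cauchy dual of `S`. -/
noncomputable def modelEval (S : Fin d → H →L[ℂ] H) (z : Fin d → ℂ) : H →L[ℂ] jointKernel S :=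
  (jointKernel S).orthogonalProjectionOnto ∘L jointResolvent (adjointTuple (toralCauchyDual S)) z

theorem polydisc_modelRadius (S : Fin d → H →L[ℂ] H) :
    polydisc (modelRadius S) = resolventPolydisc (adjointTuple (toralCauchyDual S)) := by
  have h : modelRadius S = fun j => (spectralRadius ℂ (adjointTuple (toralCauchyDual S) j))⁻¹ :=
    funext fun j => by
      rw [adjointTuple, ← ContinuousLinearMap.star_eq_adjoint, spectralRadius_star, modelRadius]
  rw [h]

theorem differentiableAt_modelEval_apply (f : H) {z : Fin d → ℂ}
    (hz : z ∈ polydisc (modelRadius S)) : DifferentiableAt ℂ (fun w => modelEval S w f) z := by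
  have h := differentiableAt_jointResolvent _ (polydisc_modelRadius S ▸ hz)
  exact (jointKernel S).orthogonalProjectionOnto.differentiableAt.comp z
    (h.clm_apply (differentiableAt_const f))

theorem modelEval_apply_eq_update_add (hdual : IsCommuting (toralCauchyDual S)) {z : Fin d → ℂ}
    (hz : z ∈ polydisc (modelRadius S)) (j : Fin d) (f : H) :
    modelEval S z f = modelEval S (Function.update z j 0) f
      + z j • modelEval S z (adjointTuple (toralCauchyDual S) j f) := by
  have h := jointResolvent_eq_update_add hdual.adjointTuple (polydisc_modelRadius S ▸ hz) j
  have h2 := congrArg (fun T : H →L[ℂ] H => (jointKernel S).orthogonalProjectionOnto (T f)) h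
  simpa [modelEval] using h2

theorem projection_opPow_eq_zero_iff (hdual : IsCommuting (toralCauchyDual S)) (α : Fin d → ℕ)
    (f : H) :
    (jointKernel S).orthogonalProjectionOnto (opPow (adjointTuple (toralCauchyDual S)) α f) = 0 ↔
      ∀ x ∈ jointKernel S, ⟪opPow (toralCauchyDual S) α x, f⟫_ℂ = 0 := by
  rw [Submodule.orthogonalProjectionOnto_eq_zero_iff, Submodule.mem_orthogonal]
  simp only [← adjoint_opPow hdual, ContinuousLinearMap.adjoint_inner_right]

theorem hasSum_modelEval_apply {z : Fin d → ℂ} (hz : z ∈ polydisc (modelRadius S)) (f : H) :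
    HasSum (fun α : Fin d → ℕ => (∏ j, z j ^ α j) • (jointKernel S).orthogonalProjectionOnto
      (opPow (adjointTuple (toralCauchyDual S)) α f)) (modelEval S z f) := by
  have h := (hasSum_jointResolvent _ (polydisc_modelRadius S ▸ hz)).2
  have h2 := (h.mapL (ContinuousLinearMap.apply ℂ H f)).mapL
    (jointKernel S).orthogonalProjectionOnto
  simpa [modelEval] using h2

/-- The model map intertwines `S_j` with the multiplication by `z_j`: the part of the series of
`S_j f` which is free of `z_j` vanishes by the kernel condition. -/
theorem modelEval_apply_apply (hS : IsToralLeftInvertible S)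
    (hdual : IsCommuting (toralCauchyDual S)) (hK : KernelCondition S) {z : Fin d → ℂ}
    (hz : z ∈ polydisc (modelRadius S)) (j : Fin d) (f : H) :
    modelEval S z (S j f) = z j • modelEval S z f := by
  have hz0 : Function.update z j 0 ∈ polydisc (modelRadius S) := by
    rw [polydisc_modelRadius] at hz ⊢
    exact update_mem_resolventPolydisc hz j
  have h0 : modelEval S (Function.update z j 0) (S j f) = 0 := by
    refine (hasSum_modelEval_apply hz0 (S j f)).unique ?_
    convert hasSum_zero with α
    by_cases hα : α j = 0
    · rw [(projection_opPow_eq_zero_iff hdual α (S j f)).mpr, smul_zero]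
      intro x hx
      rw [← ContinuousLinearMap.adjoint_inner_left]
      have h := hK.apply_eq_zero hx j hα
      rw [adjointTuple] at h
      rw [h, inner_zero_left]
    · rw [Finset.prod_eq_zero (Finset.mem_univ j) (by simp [hα]), zero_smul]
  have h1 : adjointTuple (toralCauchyDual S) j (S j f) = f :=
    DFunLike.congr_fun (hS.adjoint_dual_mul j) f
  rw [modelEval_apply_eq_update_add hdual hz j, h0, zero_add, h1]

/-- The set of the vectors represented by the zero function is invariant under `A_j*`, where `A` is
the Cauchy dual: the resolvent identity gives `z_j • modelEval S z (A_j* f) = 0`, whence the claim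
for `z_j ≠ 0`, and the other points follow by continuity. -/
theorem modelEval_adjoint_dual_eq_zero (hdual : IsCommuting (toralCauchyDual S)) {f : H}
    (hf : ∀ z ∈ polydisc (modelRadius S), modelEval S z f = 0) (j : Fin d) {z : Fin d → ℂ}
    (hz : z ∈ polydisc (modelRadius S)) :
    modelEval S z (adjointTuple (toralCauchyDual S) j f) = 0 := by
  set g := adjointTuple (toralCauchyDual S) j f with hg
  have key : ∀ w ∈ polydisc (modelRadius S), w j ≠ 0 → modelEval S w g = 0 := by
    intro w hw hwj
    have hw0 : Function.update w j 0 ∈ polydisc (modelRadius S) := by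
      rw [polydisc_modelRadius] at hw ⊢
      exact update_mem_resolventPolydisc hw j
    have h := modelEval_apply_eq_update_add hdual hw j f
    rw [hf w hw, hf _ hw0, zero_add] at h
    exact (smul_eq_zero.mp h.symm).resolve_left hwj
  by_cases hzj : z j = 0
  · -- Perturb the vanishing coordinate and let the perturbation tend to zero.
    have hupd : Function.update z j 0 = z := by rw [← hzj, Function.update_eq_self]
    have hcont : ContinuousAt (fun t : ℂ => modelEval S (Function.update z j t) g) 0 := by
      have h1 : ContinuousAt (fun w => modelEval S w g) (Function.update z j 0) :=
        hupd.symm ▸ (differentiableAt_modelEval_apply g hz).continuousAt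
      exact h1.comp (f := fun t : ℂ => Function.update z j t)
        (continuous_const.update j continuous_id).continuousAt
    have h2 : Filter.Tendsto (fun t : ℂ => modelEval S (Function.update z j t) g)
        (nhdsWithin 0 {0}ᶜ) (nhds (modelEval S z g)) := by
      have h := hcont.tendsto.mono_left (nhdsWithin_le_nhds (s := {0}ᶜ))
      rwa [hupd] at h
    refine tendsto_nhds_unique_of_eventuallyEq h2 (tendsto_const_nhds (x := 0)) ?_
    have h3 : ∀ᶠ t : ℂ in nhds 0, ‖t‖ₑ < modelRadius S j := by
      refine (continuous_enorm.tendsto (0 : ℂ)).eventually_lt_const ?_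
      have := hz j
      rwa [hzj] at this
    filter_upwards [nhdsWithin_le_nhds h3, self_mem_nhdsWithin] with t ht ht0
    refine key _ (fun i => ?_) (by simpa using ht0)
    rcases eq_or_ne i j with rfl | hij
    · simpa using ht
    · simpa [hij] using hz i
  · exact key z hz hzj

/-- A vector killed by all evaluations is orthogonal to all the spaces `A^α E`, where `A` is the
Cauchy dual: the set of such vectors is invariant under each `A_j*`, and the evaluation at the
origin is `P_E`. -/
theorem inner_opPow_eq_zero_of_modelEval_eq_zero (hdual : IsCommuting (toralCauchyDual S)) {f : H}
    (hf : ∀ z ∈ polydisc (modelRadius S), modelEval S z f = 0) (α : Fin d → ℕ) {x : H}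
    (hx : x ∈ jointKernel S) : ⟪opPow (toralCauchyDual S) α x, f⟫_ℂ = 0 := by
  refine (projection_opPow_eq_zero_iff hdual α f).mp ?_ x hx
  have h : ∀ z ∈ polydisc (modelRadius S),
      modelEval S z (opPow (adjointTuple (toralCauchyDual S)) α f) = 0 := by
    induction α using multiIndex_induction with
    | zero => simpa using hf
    | add_single α j ih =>
      intro z hz
      rw [opPow_add_single hdual.adjointTuple]
      exact modelEval_adjoint_dual_eq_zero hdual ih j hz
  have h0 := h 0 (polydisc_modelRadius S ▸ zero_mem_resolventPolydisc _)
  simpa [modelEval] using h0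

/-- The expansion of the reproducing kernel of the model. -/
theorem hasSum_modelEval_comp_adjoint (hdual : IsCommuting (toralCauchyDual S)) {z w : Fin d → ℂ}
    (hz : z ∈ polydisc (modelRadius S)) (hw : w ∈ polydisc (modelRadius S)) :
    HasSum (fun p : (Fin d → ℕ) × (Fin d → ℕ) =>
        ((∏ j, z j ^ p.1 j) * ∏ j, conj (w j) ^ p.2 j) • kernelCoeff S p.1 p.2)
      (modelEval S z ∘L ContinuousLinearMap.adjoint (modelEval S w)) := by
  set B := adjointTuple (toralCauchyDual S) with hB
  obtain ⟨hz1, hz2⟩ := hasSum_jointResolvent B (polydisc_modelRadius S ▸ hz)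
  obtain ⟨hw1, hw2⟩ := hasSum_jointResolvent B (polydisc_modelRadius S ▸ hw)
  have hstar : (fun β : Fin d → ℕ => star ((∏ j, w j ^ β j) • opPow B β))
      = fun β => (∏ j, conj (w j) ^ β j) • opPow (toralCauchyDual S) β := by
    funext β
    have h : star (opPow B β) = opPow (toralCauchyDual S) β := by
      rw [hB, ← adjoint_opPow hdual, ContinuousLinearMap.star_eq_adjoint,
        ContinuousLinearMap.adjoint_adjoint]
    rw [star_smul, h]
    simp
  have hw3 := hw2.star
  rw [hstar] at hw3
  have hw4 : Summable fun β : Fin d → ℕ =>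
      ‖(∏ j, conj (w j) ^ β j) • opPow (toralCauchyDual S) β‖ := by
    refine hw1.congr fun β => ?_
    rw [← congrFun hstar β, norm_star]
  have hs := summable_mul_of_summable_norm hz1 hw4
  have hprod := HasSum.mul hz2 hw3 hs
  have h1 := hprod.mapL
    (((ContinuousLinearMap.compL ℂ (jointKernel S) H (jointKernel S))
      (jointKernel S).orthogonalProjectionOnto) ∘L
      ((ContinuousLinearMap.compL ℂ (jointKernel S) H H).flip (jointKernel S).subtypeL))
  convert h1 using 1
  · funext p
    ext x
    simp [kernelCoeff, smul_smul, hB, mul_comm]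
  · rw [modelEval, modelEval, ContinuousLinearMap.adjoint_comp,
      Submodule.adjoint_orthogonalProjectionOnto]
    rfl

theorem hasSum_modelEval_comp_adjoint_subtype (hdual : IsCommuting (toralCauchyDual S))
    {z w : Fin d → ℂ} (hz : z ∈ polydisc (modelRadius S)) (hw : w ∈ polydisc (modelRadius S))
    {s : Set ((Fin d → ℕ) × (Fin d → ℕ))} (hs : ∀ p ∉ s, kernelCoeff S p.1 p.2 = 0) :
    HasSum (fun p : s =>
        ((∏ j, z j ^ p.1.1 j) * ∏ j, conj (w j) ^ p.1.2 j) • kernelCoeff S p.1.1 p.1.2)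
      (modelEval S z ∘L ContinuousLinearMap.adjoint (modelEval S w)) := by
  refine (hasSum_subtype_iff_of_support_subset fun p hp => ?_).mpr
    (hasSum_modelEval_comp_adjoint hdual hz hw)
  by_contra h
  exact hp (by ext x; simp [hs p h])

end Model

/-! ### Depth in rooted directed trees -/

section Depth

variable {V : Type*} {G : Digraph V}

theorem adj_parent {v : V} (hv : ¬ IsRoot G v) : G.Adj (parent G v) v := by
  have h : ∃ u, G.Adj u v := by simpa [IsRoot] using hv
  rw [parent, dif_pos h]
  exact h.choose_spec

theorem IsDirectedTree.eq_of_adj (hG : IsDirectedTree G) {u u' v : V} (h : G.Adj u v)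
    (h' : G.Adj u' v) : u = u' :=
  (hG.unique_parent v fun hr => hr u h).unique h h'

theorem IsDirectedTree.exists_mem_childrenIter (hG : IsDirectedTree G) {ρ : V}
    (hρ : IsRoot G ρ) (v : V) : ∃ n, v ∈ childrenIter G n {ρ} := by
  rcases eq_or_ne ρ v with rfl | hne
  · exact ⟨0, rfl⟩
  obtain ⟨n, p, -, h0, hn, hp⟩ := hG.connected ρ v hne
  -- The vertices reachable from the root are closed under children and under parents, hence
  -- every undirected path from the root consists of such vertices.
  have key : ∀ i : Fin (n + 1), ∃ m, p i ∈ childrenIter G m {ρ} := by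
    intro i
    induction i using Fin.induction with
    | zero => exact ⟨0, h0⟩
    | succ i ih =>
      obtain ⟨m, hm⟩ := ih
      rcases hp i with h | h
      · exact ⟨m + 1, _, hm, h⟩
      · cases m with
        | zero =>
          have h2 : p i.castSucc = ρ := hm
          exact absurd (h2 ▸ h) (hρ _)
        | succ m =>
          obtain ⟨u, hu, hadj⟩ := hm
          exact ⟨m, hG.eq_of_adj hadj h ▸ hu⟩
  exact hn ▸ key (Fin.last n)

theorem IsDirectedTree.childrenIter_inj (hG : IsDirectedTree G) {ρ : V} (hρ : IsRoot G ρ) {v : V}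
    {m n : ℕ} (hm : v ∈ childrenIter G m {ρ}) (hn : v ∈ childrenIter G n {ρ}) : m = n := by
  induction m generalizing n v with
  | zero =>
    cases n with
    | zero => rfl
    | succ n =>
      obtain ⟨u, -, hu⟩ := hn
      have h2 : v = ρ := hm
      exact absurd (h2 ▸ hu) (hρ u)
  | succ m ih =>
    obtain ⟨u, hu, hadj⟩ := hm
    cases n with
    | zero =>
      have h2 : v = ρ := hn
      exact absurd (h2 ▸ hadj) (hρ u)
    | succ n =>
      obtain ⟨u', hu', hadj'⟩ := hn
      rw [ih hu (hG.eq_of_adj hadj hadj' ▸ hu')]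

theorem IsDirectedTree.depth_eq (hG : IsDirectedTree G) (hr : IsRooted G) {ρ : V}
    (hρ : IsRoot G ρ) {v : V} {n : ℕ} (hn : v ∈ childrenIter G n {ρ}) : depth G v = n := by
  have h : {n | ∃ ρ, IsRoot G ρ ∧ v ∈ childrenIter G n {ρ}} = {n} := by
    ext m
    refine ⟨?_, fun h => ⟨ρ, hρ, (Set.mem_singleton_iff.mp h) ▸ hn⟩⟩
    rintro ⟨ρ', hρ', hm⟩
    rw [hr.unique hρ' hρ] at hm
    exact hG.childrenIter_inj hρ hm hn
  rw [depth, h, csInf_singleton]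

theorem IsDirectedTree.depth_eq_parent_add_one (hG : IsDirectedTree G) (hr : IsRooted G) {v : V}
    (hv : ¬ IsRoot G v) : depth G v = depth G (parent G v) + 1 := by
  obtain ⟨ρ, hρ⟩ := hr.exists
  obtain ⟨n, hn⟩ := hG.exists_mem_childrenIter hρ (parent G v)
  have hn' : v ∈ childrenIter G (n + 1) {ρ} := ⟨_, hn, adj_parent hv⟩
  rw [hG.depth_eq hr hρ hn, hG.depth_eq hr hρ hn']

theorem IsDirectedTree.depth_of_isRoot (hG : IsDirectedTree G) (hr : IsRooted G) {v : V}
    (hv : IsRoot G v) : depth G v = 0 :=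
  hG.depth_eq hr hv (n := 0) rfl

theorem IsDirectedTree.depth_le_branchingIndex (hG : IsDirectedTree G) (hr : IsRooted G) {v w : V}
    (hv : ¬ IsRoot G v) (hw : G.Adj (parent G v) w) (hne : w ≠ v) :
    (depth G v : ℕ∞) ≤ branchingIndex G := by
  have hb : parent G v ∈ branchingVertices G := by
    have hsub : ({w, v} : Set V) ⊆ children G {parent G v} := by
      rintro x (rfl | rfl)
      · exact ⟨_, rfl, hw⟩
      · exact ⟨_, rfl, adj_parent hv⟩
    calc (2 : ℕ∞) = ({w, v} : Set V).encard := (Set.encard_pair hne).symm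
      _ ≤ _ := Set.encard_le_encard hsub
  rw [branchingIndex, if_pos ⟨_, hb⟩, hG.depth_eq_parent_add_one hr hv, Nat.cast_add, Nat.cast_one,
    add_comm]
  gcongr
  exact le_iSup₂ (f := fun w (_ : w ∈ branchingVertices G) => (depth G w : ℕ∞)) _ hb

end Depth

/-! ### Multishifts on the standard basis -/

section Shift

open Classical in
/-- The members of the standard orthonormal basis of `l²(X)`. -/
noncomputable def basisVec {X : Type*} (x : X) : L2 X := lp.single 2 x (1 : ℂ)

theorem basisVec_apply_self {X : Type*} (x : X) : basisVec x x = 1 := by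
  simp [basisVec]

theorem basisVec_apply_ne {X : Type*} {x y : X} (h : y ≠ x) : basisVec x y = 0 := by
  simp [basisVec, h]

theorem inner_basisVec {X : Type*} (x : X) (f : L2 X) : ⟪basisVec x, f⟫_ℂ = f x := by
  simp [basisVec, lp.inner_single_left]

/-- Square summable functions with disjoint supports are orthogonal. -/
theorem inner_eq_zero_of_disjoint_support {X : Type*} {f g : L2 X}
    (h : ∀ x, f x ≠ 0 → g x = 0) : ⟪f, g⟫_ℂ = 0 := by
  rw [lp.inner_eq_tsum]
  convert tsum_zero with x
  by_cases hx : f x = 0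
  · rw [hx, inner_zero_left]
  · rw [h x hx, inner_zero_right]

variable {d : ℕ} {V : Fin d → Type*} {T : ∀ j, Digraph (V j)} {lam : Fin d → (∀ j, V j) → ℂ}
  {S : Fin d → L2 (∀ j, V j) →L[ℂ] L2 (∀ j, V j)}

theorem IsBoundedMultishift.apply_eq (hS : IsBoundedMultishift T lam S) (j : Fin d)
    (f : L2 (∀ j, V j)) (v : ∀ j, V j) : S j f v = shiftAction T lam j f v := by
  have h : ((f, S j f) : L2 (∀ j, V j) × L2 (∀ j, V j)) ∈ (multishift T lam j).graph := by
    rw [hS j, LinearPMap.mem_graph_iff]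
    exact ⟨⟨f, trivial⟩, rfl, rfl⟩
  rw [LinearPMap.mem_graph_iff] at h
  obtain ⟨y, hy, hy2⟩ := h
  have h2 : S j f = multishift T lam j y := hy2.symm
  rw [h2, ← show (y : L2 (∀ j, V j)) = f from hy]
  rfl

theorem IsBoundedMultishift.apply_of_isRoot (hS : IsBoundedMultishift T lam S) {j : Fin d}
    {v : ∀ j, V j} (hv : IsRoot (T j) (v j)) (f : L2 (∀ j, V j)) : S j f v = 0 := by
  rw [hS.apply_eq]
  exact if_pos hv

theorem IsBoundedMultishift.apply_of_not_isRoot (hS : IsBoundedMultishift T lam S) {j : Fin d}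
    {v : ∀ j, V j} (hv : ¬ IsRoot (T j) (v j)) (f : L2 (∀ j, V j)) :
    S j f v = lam j v * f (Function.update v j (parent (T j) (v j))) := by
  rw [hS.apply_eq]
  exact if_neg hv

theorem IsBoundedMultishift.adjoint_basisVec_of_isRoot (hS : IsBoundedMultishift T lam S)
    {j : Fin d} {v : ∀ j, V j} (hv : IsRoot (T j) (v j)) :
    adjointTuple S j (basisVec v) = 0 := by
  refine ext_inner_right ℂ fun f => ?_
  rw [adjointTuple, ContinuousLinearMap.adjoint_inner_left, inner_basisVec,
    hS.apply_of_isRoot hv, inner_zero_left]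

theorem IsBoundedMultishift.adjoint_basisVec_of_not_isRoot (hS : IsBoundedMultishift T lam S)
    {j : Fin d} {v : ∀ j, V j} (hv : ¬ IsRoot (T j) (v j)) :
    adjointTuple S j (basisVec v)
      = conj (lam j v) • basisVec (Function.update v j (parent (T j) (v j))) := by
  refine ext_inner_right ℂ fun f => ?_
  rw [adjointTuple, ContinuousLinearMap.adjoint_inner_left, inner_basisVec,
    hS.apply_of_not_isRoot hv, inner_smul_left, inner_basisVec, Complex.conj_conj]

/-- `S_j*` moves the basis vectors towards the root, in the direction of the `j`-th tree. -/
theorem IsBoundedMultishift.adjoint_pow_basisVec (hS : IsBoundedMultishift T lam S)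
    (hT : ∀ j, IsDirectedTree (T j)) (hroot : ∀ j, IsRooted (T j)) (j : Fin d) {n : ℕ}
    {v : ∀ j, V j} (hn : depth (T j) (v j) < n) : (adjointTuple S j ^ n) (basisVec v) = 0 := by
  induction n generalizing v with
  | zero => simp at hn
  | succ n ih =>
    rw [pow_succ, mul_apply_eq_comp]
    by_cases hv : IsRoot (T j) (v j)
    · rw [hS.adjoint_basisVec_of_isRoot hv, map_zero]
    · rw [hS.adjoint_basisVec_of_not_isRoot hv, map_smul, ih, smul_zero]
      have h := (hT j).depth_eq_parent_add_one (hroot j) hv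
      rw [Function.update_self]
      omega

theorem IsBoundedMultishift.finite_opPow_adjoint_basisVec (hS : IsBoundedMultishift T lam S)
    (hT : ∀ j, IsDirectedTree (T j)) (hroot : ∀ j, IsRooted (T j)) (hcomm : IsCommuting S)
    (v : ∀ j, V j) : {γ | opPow (adjointTuple S) γ (basisVec v) ≠ 0}.Finite := by
  refine (Set.finite_Iic fun j => depth (T j) (v j)).subset fun γ hγ j => ?_
  by_contra! h
  refine hγ ?_
  have h1 : γ = Function.update γ j 0 + Pi.single j (γ j) := by
    funext i
    rcases eq_or_ne i j with rfl | hij <;> simp [*]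
  rw [h1, opPow_add hcomm.adjointTuple, opPow_single, mul_apply_eq_comp,
    hS.adjoint_pow_basisVec hT hroot j h, map_zero]

/-! ### Supports -/

/-- `S_j* S_j` is diagonal with nonzero diagonal entries. -/
theorem IsBoundedMultishift.apply_eq_zero_of_adjoint_mul_apply (hS : IsBoundedMultishift T lam S)
    (hinv : IsToralLeftInvertible S) (j : Fin d) {g : L2 (∀ j, V j)} {v : ∀ j, V j}
    (h : (adjointTuple S j * S j) g v = 0) : g v = 0 := by
  have h1 : ⟪S j (basisVec v), S j (g - g v • basisVec v)⟫_ℂ = 0 := by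
    refine inner_eq_zero_of_disjoint_support fun x hx => ?_
    by_cases hr : IsRoot (T j) (x j)
    · exact hS.apply_of_isRoot hr _
    · rw [hS.apply_of_not_isRoot hr] at hx ⊢
      have hxv : Function.update x j (parent (T j) (x j)) = v := by
        by_contra hne
        rw [basisVec_apply_ne hne, mul_zero] at hx
        exact hx rfl
      rw [hxv, lp.coeFn_sub, lp.coeFn_smul, Pi.sub_apply, Pi.smul_apply, basisVec_apply_self,
        smul_eq_mul, mul_one, sub_self, mul_zero]
  have h2 : ⟪S j (basisVec v), S j g⟫_ℂ = 0 := by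
    rw [← ContinuousLinearMap.adjoint_inner_right, ← h, inner_basisVec]
    rfl
  rw [map_sub, inner_sub_right, h2, map_smul, inner_smul_right, zero_sub, neg_eq_zero,
    mul_eq_zero] at h1
  refine h1.resolve_right fun h3 => ?_
  have h4 : basisVec v = 0 := by
    have h5 := DFunLike.congr_fun (hinv.adjoint_dual_mul j) (basisVec v)
    rw [mul_apply_eq_comp, inner_self_eq_zero.mp h3, map_zero] at h5
    exact h5.symm
  have h6 := basisVec_apply_self v
  rw [h4] at h6
  simp at h6

/-- The Cauchy dual of a multishift is supported like a multishift. -/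
theorem IsBoundedMultishift.dual_apply_ne_zero (hS : IsBoundedMultishift T lam S)
    (hinv : IsToralLeftInvertible S) {j : Fin d} {f : L2 (∀ j, V j)} {v : ∀ j, V j}
    (h : toralCauchyDual S j f v ≠ 0) :
    ¬ IsRoot (T j) (v j) ∧ f (Function.update v j (parent (T j) (v j))) ≠ 0 := by
  rw [toralCauchyDual, mul_apply_eq_comp] at h
  have hr : ¬ IsRoot (T j) (v j) := fun hr => h (hS.apply_of_isRoot hr _)
  refine ⟨hr, fun h0 => h ?_⟩
  rw [hS.apply_of_not_isRoot hr, hS.apply_eq_zero_of_adjoint_mul_apply hinv j, mul_zero]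
  rw [← mul_apply_eq_comp, Ring.mul_inverse_cancel _ (hinv.2 j)]
  exact h0

/-- The Cauchy dual raises the depths: a vertex in the support of `A^α f` lies, in each coordinate
`j`, deeper by `α_j` than some vertex in the support of `f`. -/
theorem IsBoundedMultishift.opPow_dual_apply_ne_zero (hS : IsBoundedMultishift T lam S)
    (hT : ∀ j, IsDirectedTree (T j)) (hroot : ∀ j, IsRooted (T j))
    (hinv : IsToralLeftInvertible S) (hdual : IsCommuting (toralCauchyDual S)) (α : Fin d → ℕ)
    {f : L2 (∀ j, V j)} {v : ∀ j, V j} (h : opPow (toralCauchyDual S) α f v ≠ 0) :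
    ∃ u, f u ≠ 0 ∧ ∀ j, depth (T j) (v j) = depth (T j) (u j) + α j := by
  induction α using multiIndex_induction generalizing v with
  | zero => exact ⟨v, by simpa using h, by simp⟩
  | add_single α j ih =>
    rw [opPow_add_single hdual, mul_apply_eq_comp] at h
    obtain ⟨hr, h1⟩ := hS.dual_apply_ne_zero hinv h
    obtain ⟨u, hu, hd⟩ := ih h1
    refine ⟨u, hu, fun i => ?_⟩
    have hi := hd i
    rcases eq_or_ne i j with rfl | hij
    · rw [Function.update_self] at hi
      rw [(hT i).depth_eq_parent_add_one (hroot i) hr, hi]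
      simp [add_assoc]
    · rw [Function.update_of_ne hij] at hi
      simp [hi, hij]

/-- A vertex in the support of a member of `E` has in each coordinate a root or a vertex with a
sibling: for a vertex `v` without a `j`-th sibling, `S_j` maps a basis vector to a nonzero
multiple of `basisVec v`. -/
theorem IsBoundedMultishift.depth_le_of_mem_jointKernel (hS : IsBoundedMultishift T lam S)
    (hT : ∀ j, IsDirectedTree (T j)) (hroot : ∀ j, IsRooted (T j))
    (hlam : ∀ j v, ¬ IsRoot (cartesianProduct T) v → lam j v ≠ 0) {f : L2 (∀ j, V j)}
    (hf : f ∈ jointKernel S) {v : ∀ j, V j} (hv : f v ≠ 0) (j : Fin d) :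
    (depth (T j) (v j) : ℕ∞) ≤ branchingIndex (T j) := by
  by_cases hr : IsRoot (T j) (v j)
  · simp [(hT j).depth_of_isRoot (hroot j) hr]
  by_contra hlt
  have hsib : ∀ w, (T j).Adj (parent (T j) (v j)) w → w = v j := fun w hw => by
    by_contra hne
    exact hlt ((hT j).depth_le_branchingIndex (hroot j) hr hw hne)
  set u := Function.update v j (parent (T j) (v j)) with hu
  have h1 : S j (basisVec u) = lam j v • basisVec v := by
    refine lp.ext (funext fun x => ?_)
    rw [lp.coeFn_smul, Pi.smul_apply, smul_eq_mul]
    rcases eq_or_ne x v with rfl | hxv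
    · rw [hS.apply_of_not_isRoot hr, ← hu, basisVec_apply_self, basisVec_apply_self]
    rw [basisVec_apply_ne hxv, mul_zero]
    by_cases hx : IsRoot (T j) (x j)
    · exact hS.apply_of_isRoot hx _
    rw [hS.apply_of_not_isRoot hx, basisVec_apply_ne, mul_zero]
    intro hxu
    refine hxv (funext fun i => ?_)
    have hi := congrFun hxu i
    rcases eq_or_ne i j with rfl | hij
    · rw [hu, Function.update_self, Function.update_self] at hi
      exact hsib _ (hi ▸ adj_parent hx)
    · rwa [hu, Function.update_of_ne hij, Function.update_of_ne hij] at hi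
  have h2 : ⟪S j (basisVec u), f⟫_ℂ = 0 := by
    rw [← ContinuousLinearMap.adjoint_inner_right]
    have h3 := mem_jointKernel.mp hf j
    rw [adjointTuple] at h3
    rw [h3, inner_zero_right]
  rw [h1, inner_smul_left, inner_basisVec, mul_eq_zero] at h2
  have hlv : lam j v ≠ 0 := hlam j v fun hrv =>
    hrv u ⟨j, fun i hij => Function.update_of_ne hij _ _, by
      rw [hu, Function.update_self]; exact adj_parent hr⟩
  rcases h2 with h2 | h2
  · exact hlv ((map_eq_zero _).mp h2)
  · exact hv h2

/-- If the operator were nonzero, then for some `x`, `y` in `E` a vertex would lie in the supports of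
both `A^α y` and `A^β x`. Its `j`-th depth is `α_j` plus the depth of a vertex in the support of
`y`, and `β_j` plus that of a vertex in the support of `x`; the latter two depths are at most the
branching index. -/
theorem IsBoundedMultishift.kernelCoeff_eq_zero (hS : IsBoundedMultishift T lam S)
    (hT : ∀ j, IsDirectedTree (T j)) (hroot : ∀ j, IsRooted (T j))
    (hlam : ∀ j v, ¬ IsRoot (cartesianProduct T) v → lam j v ≠ 0)
    (hinv : IsToralLeftInvertible S) (hdual : IsCommuting (toralCauchyDual S)) {α β : Fin d → ℕ}
    {j : Fin d} (hαβ : ¬ ((((α j : ℤ) - β j).natAbs : ℕ) : ℕ∞) ≤ branchingIndex (T j)) :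
    kernelCoeff S α β = 0 := by
  ext1 x
  refine (projection_opPow_eq_zero_iff hdual α _).mpr fun y hy => ?_
  refine inner_eq_zero_of_disjoint_support fun v hv => ?_
  by_contra hv2
  obtain ⟨u, hu, hud⟩ := hS.opPow_dual_apply_ne_zero hT hroot hinv hdual α hv
  obtain ⟨w, hw, hwd⟩ := hS.opPow_dual_apply_ne_zero hT hroot hinv hdual β hv2
  have h1 := hS.depth_le_of_mem_jointKernel hT hroot hlam hy hu j
  have h2 := hS.depth_le_of_mem_jointKernel hT hroot hlam x.2 hw j
  have h3 : ((α j : ℤ) - β j).natAbs ≤ max (depth (T j) (u j)) (depth (T j) (w j)) := by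
    have := hud j
    have := hwd j
    omega
  refine hαβ (le_trans (Nat.cast_le.mpr h3) ?_)
  rcases max_choice (depth (T j) (u j)) (depth (T j) (w j)) with h | h <;> rwa [h]

/-! ### Injectivity of the model map -/

theorem IsBoundedMultishift.eq_zero_of_modelEval_eq_zero (hS : IsBoundedMultishift T lam S)
    (hT : ∀ j, IsDirectedTree (T j)) (hroot : ∀ j, IsRooted (T j))
    (hinv : IsToralLeftInvertible S) (hdual : IsCommuting (toralCauchyDual S))
    (hK : KernelCondition S) {f : L2 (∀ j, V j)}
    (hf : ∀ z ∈ polydisc (modelRadius S), modelEval S z f = 0) : f = 0 := by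
  have hle : (⨆ β, (jointKernel S).map (opPow (toralCauchyDual S) β : _ →ₗ[ℂ] _))
      ≤ (ℂ ∙ f)ᗮ := by
    refine iSup_le fun β => ?_
    rintro _ ⟨x, hx, rfl⟩
    rw [Submodule.mem_orthogonal_singleton_iff_inner_left]
    exact inner_opPow_eq_zero_of_modelEval_eq_zero hdual hf β hx
  refine lp.ext (funext fun v => ?_)
  have h := hle (mem_iSup_map_opPow hinv hdual hK _
    (hS.finite_opPow_adjoint_basisVec hT hroot hinv.1 v))
  rw [Submodule.mem_orthogonal_singleton_iff_inner_left, inner_basisVec] at h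
  exact h

end Shift

/-! ### The reproducing kernel Hilbert space -/

/-- The Hilbert space `H` of a tuple, regarded as a space of functions on the polydisc by means of
the model evaluations. -/
noncomputable abbrev modelRKHS {d : ℕ} {H : Type*} [NormedAddCommGroup H] [InnerProductSpace ℂ H]
    [CompleteSpace H] (S : Fin d → H →L[ℂ] H)
    (hinj : ∀ f : H, (∀ z ∈ polydisc (modelRadius S), modelEval S z f = 0) → f = 0) :
    RKHS ℂ H (polydisc (modelRadius S)) (jointKernel S) where
  coeCLM := ContinuousLinearMap.pi fun z => modelEval S z
  coeCLM_injective := (injective_iff_map_eq_zero _).mpr fun f hf =>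
    hinj f fun z hz => congrFun hf ⟨z, hz⟩

end TreeShift

theorem mainTheorem4 {d : ℕ} (hd : 0 < d) {V : Fin d → Type u} (T : ∀ j, Digraph (V j))
    (hT : ∀ j, IsDirectedTree (T j)) (hroot : ∀ j, IsRooted (T j))
    (hleaf : ∀ j, IsLeafless (T j)) (hfin : ∀ j, IsLocallyFinite (T j))
    (lam : Fin d → (∀ j, V j) → ℂ)
    (hlam : ∀ j v, ¬ IsRoot (cartesianProduct T) v → lam j v ≠ 0)
    (S : Fin d → L2 (∀ j, V j) →L[ℂ] L2 (∀ j, V j))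
    (hS : IsBoundedMultishift T lam S)
    (hinv : IsToralLeftInvertible S)
    (hdual : IsCommuting (toralCauchyDual S))
    (hK : KernelCondition S) :
    ∃ (H : Type u) (_ : NormedAddCommGroup H) (_ : InnerProductSpace ℂ H) (_ : CompleteSpace H)
      (_ : RKHS ℂ H (polydisc (modelRadius S)) (jointKernel S)),
      (∀ F : H, IsHolomorphicOnPolydisc (F : polydisc (modelRadius S) → jointKernel S)) ∧
      ∃ (U : L2 (∀ j, V j) ≃ₗᵢ[ℂ] H) (M : Fin d → H →L[ℂ] H),
        (∀ (j : Fin d) (F : H) (z : polydisc (modelRadius S)), M j F z = (z : Fin d → ℂ) j • F z) ∧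
        (∀ (j : Fin d) (f : L2 (∀ j, V j)), U (S j f) = M j (U f)) ∧
        ((∀ j, branchingIndex (T j) ≠ ⊤) →
          ∀ z w : polydisc (modelRadius S),
            HasSum (fun p : {p : (Fin d → ℕ) × (Fin d → ℕ) //
                ∀ j, (((p.1 j : ℤ) - p.2 j).natAbs : ℕ∞) ≤ branchingIndex (T j)} =>
              ((∏ j, (z : Fin d → ℂ) j ^ p.1.1 j) * ∏ j, conj ((w : Fin d → ℂ) j) ^ p.1.2 j) •
                kernelCoeff S p.1.1 p.1.2)
              (RKHS.kernel H z w)) := by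
  let := modelRKHS S fun f => hS.eq_zero_of_modelEval_eq_zero hT hroot hinv hdual hK
  refine ⟨L2 (∀ j, V j), inferInstance, inferInstance, inferInstance, this, ?_,
    LinearIsometryEquiv.refl ℂ _, S, ?_, fun j f => rfl, ?_⟩
  · exact fun F => ⟨fun z => modelEval S z F,
      fun z hz => (differentiableAt_modelEval_apply F hz).differentiableWithinAt, fun z => rfl⟩
  · exact fun j F z => modelEval_apply_apply hinv hdual hK z.2 j F
  · intro _ z w
    have hker : RKHS.kernel (L2 (∀ j, V j)) z w
        = modelEval S z ∘L ContinuousLinearMap.adjoint (modelEval S w) := by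
      ext1 x
      rw [← RKHS.kerFun_apply]
      rfl
    rw [hker]
    refine hasSum_modelEval_comp_adjoint_subtype
      (s := {p | ∀ j, (((p.1 j : ℤ) - p.2 j).natAbs : ℕ∞) ≤ branchingIndex (T j)})
      hdual z.2 w.2 fun p hp => ?_
    obtain ⟨j, hj⟩ := not_forall.mp hp
    exact hS.kernelCoeff_eq_zero hT hroot hlam hinv hdual hj
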